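/- Let $(K,d)$ be a complete separable metric space, and let $\mathcal M=(K_{i(e)},w_e,p_e)_{e\in E}$ be a finite Markov system on $K$. That is: $(V,E,i,t)$ is a directed multigraph with finite edge set $E$, where $i(e)$ and $t(e)$ are the initial and the terminal vertex of $e\in E$; $(K_v)_{v\in V}$ is a partition of $K$ into non-empty Borel sets; for every $e\in E$, $w_e:K_{i(e)}\to K_{t(e)}$ is a Borel map and $p_e:K_{i(e)}\to(0,1]$ is a Borel function, with $\sum_{e:\,i(e)=v}p_e(x)=1$ for all $x\in K_v$, $v\in V$. Each $p_e$ is extended to $K$ by zero and each $w_e$ is extended to $K$ arbitrarily. Assume that, for every $e\in E$, $K_{i(e)}$ is open in $K$, $w_e|_{K_{i(e)}}$ is continuous, and $p_e|_{K_{i(e)}}$ is continuous and bounded away from zero. Suppose that $\mathcal M$ is contractive, i.e. there is $0<a<1$ with $\sum_{e'\in E}p_{e'}(x)\,d(w_{e'}(x),w_{e'}(y))\le a\,d(x,y)$ for all $x,y\in K_{i(e)}$, $e\in E$. Let $Ug:=\sum_{e\in E}p_e\cdot(g\circ w_e)$, and suppose that there is exactly one Borel probability measure $\mu$ on $K$ that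 is invariant, i.e. satisfies $\int Ug\,d\mu=\int g\,d\mu$ for all bounded continuous $g:K\to\mathbb R$. For $x\in K$ let $P_x$ be the Borel probability measure on $\Sigma^+:=E^{\{1,2,\dots\}}$ (with the product of the discrete topologies) such that \[P_x(\{\sigma:\sigma_1=e_1,\dots,\sigma_n=e_n\})=p_{e_1}(x)\,p_{e_2}(w_{e_1}(x))\cdots p_{e_n}(w_{e_{n-1}}\circ\dots\circ w_{e_1}(x))\] for all $n\ge1$ and $e_1,\dots,e_n\in E$. For every $e\in E$ let $f_e:K\to[-\infty,+\infty]$ be a Borel measurable function such that $f_e|_{K_{i(e)}}$ is bounded and continuous. Then, for every $x\in K$, \[\lim_{n\to\infty}\frac1n\sum_{k=0}^{n-1}f_{\sigma_{k+1}}\bigl(w_{\sigma_k}\circ\dots\circ w_{\sigma_1}(x)\bigr)=\sum_{e\in E}\int_{K_{i(e)}}p_ef_e\,d\mu\qquad\text{for }P_x\text{-a.e. }\sigma\in\Sigma^+.\] -/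

import Mathlib

open MeasureTheory ProbabilityTheory Filter Topology

/-- A finite Markov system `(K_{i(e)}, w_e, p_e)_{e ∈ E}` on a space `K`: the sets `K_i`
(`vertexSet i`, `i ∈ V`) form a partition of `K` into non-empty Borel sets, each edge `e` from
`i(e) = ini e` to `t(e) = ter e` carries a Borel map `w_e : K_{i(e)} → K_{t(e)}`, and the positive
Borel functions `p_e` with `i(e) = i` sum up to `1` on `K_i`. As usual, `p_e` is extended to all of
`K` by zero, and `w_e` is extended to all of `K` arbitrarily. -/
structure MarkovSystem (K V E : Type*) [MeasurableSpace K] [Fintype E] where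
  vertexSet : V → Set K
  vertexSet_nonempty : ∀ i, (vertexSet i).Nonempty
  measurableSet_vertexSet : ∀ i, MeasurableSet (vertexSet i)
  vertexSet_disjoint : Pairwise fun i j => Disjoint (vertexSet i) (vertexSet j)
  iUnion_vertexSet : ⋃ i, vertexSet i = Set.univ
  ini : E → V
  ter : E → V
  w : E → K → K
  mapsTo_w : ∀ e, Set.MapsTo (w e) (vertexSet (ini e)) (vertexSet (ter e))
  measurable_w : ∀ e, Measurable fun x : vertexSet (ini e) => w e x
  p : E → K → ℝ
  p_pos : ∀ e, ∀ x ∈ vertexSet (ini e), 0 < p e x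
  p_eq_zero : ∀ e, ∀ x ∉ vertexSet (ini e), p e x = 0
  measurable_p : ∀ e, Measurable fun x : vertexSet (ini e) => p e x
  sum_p : ∀ x, ∑ e, p e x = 1

namespace MarkovSystem

section Basic

variable {K V E : Type*} [MeasurableSpace K] [Fintype E] (M : MarkovSystem K V E)

/-- The sets `K_{i(e)}` are open, the maps `w_e` are continuous on `K_{i(e)}`, and the functions
`p_e` are continuous and bounded away from zero on `K_{i(e)}`. -/
structure IsRegular [TopologicalSpace K] : Prop where
  isOpen_vertexSet : ∀ e, IsOpen (M.vertexSet (M.ini e))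
  continuousOn_w : ∀ e, ContinuousOn (M.w e) (M.vertexSet (M.ini e))
  continuousOn_p : ∀ e, ContinuousOn (M.p e) (M.vertexSet (M.ini e))
  p_bounded_below : ∀ e, ∃ δ > 0, ∀ x ∈ M.vertexSet (M.ini e), δ ≤ M.p e x

/-- Contractivity (on average) of a Markov system. -/
def IsContractive [PseudoMetricSpace K] : Prop :=
  ∃ a : ℝ, 0 < a ∧ a < 1 ∧ ∀ e, ∀ x ∈ M.vertexSet (M.ini e), ∀ y ∈ M.vertexSet (M.ini e),
    ∑ e', M.p e' x * dist (M.w e' x) (M.w e' y) ≤ a * dist x y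

/-- The Markov operator `U g = ∑ₑ pₑ · (g ∘ wₑ)`. -/
def markovOp (g : K → ℝ) (x : K) : ℝ := ∑ e, M.p e x * g (M.w e x)

/-- `ν` is invariant, i.e. `U^* ν = ν`, where `(U^* ν)(g) = ∫ U g dν` for bounded continuous `g`. -/
def IsInvariant [TopologicalSpace K] (ν : Measure K) : Prop :=
  ∀ g : BoundedContinuousFunction K ℝ, ∫ x, M.markovOp g x ∂ν = ∫ x, g x ∂ν

/-- The orbit `w_{σ_n} ∘ ⋯ ∘ w_{σ_1} (x)`; the first letter of a sequence has index `0` here. -/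
def orbit (x : K) (σ : ℕ → E) : ℕ → K
  | 0 => x
  | n + 1 => M.w (σ n) (orbit x σ n)

theorem orbit_congr (x : K) {σ τ : ℕ → E} {n : ℕ} (h : ∀ k < n, σ k = τ k) :
    M.orbit x σ n = M.orbit x τ n := by
  induction n with
  | zero => rfl
  | succ n ih =>
    simp only [orbit]
    rw [h n (Nat.lt_succ_self n), ih fun k hk => h k (hk.trans (Nat.lt_succ_self n))]

theorem p_nonneg (e : E) (x : K) : 0 ≤ M.p e x := by
  by_cases hx : x ∈ M.vertexSet (M.ini e)
  · exact (M.p_pos e x hx).le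
  · exact (M.p_eq_zero e x hx).ge

end Basic

noncomputable section PathMeasure

variable {K V E : Type*} [MeasurableSpace K] [Fintype E] [MeasurableSpace E]
  [DiscreteMeasurableSpace E] (M : MarkovSystem K V E)

/-- The law of the edge chosen in the state `y`: the edge `e` has probability `p_e(y)`. -/
def stepMeasure (y : K) : Measure E := ∑ e, ENNReal.ofReal (M.p e y) • Measure.dirac e

theorem stepMeasure_singleton (y : K) (e : E) :
    M.stepMeasure y {e} = ENNReal.ofReal (M.p e y) := by
  classical
  simp [stepMeasure, Set.indicator_apply]

instance (y : K) : IsProbabilityMeasure (M.stepMeasure y) := by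
  constructor
  simp only [stepMeasure, Measure.coe_finsetSum, Finset.sum_apply, Measure.smul_apply,
    measure_univ, smul_eq_mul, mul_one]
  rw [← ENNReal.ofReal_sum_of_nonneg fun e _ => M.p_nonneg e y, M.sum_p, ENNReal.ofReal_one]

/-- Continue a finite word, indexed by `0, …, n`, to an infinite sequence (the choice of the
continuation does not matter below). -/
def extendWord {E : Type*} {n : ℕ} (h : Finset.Iic n → E) (k : ℕ) : E :=
  h ⟨min k n, Finset.mem_Iic.2 (min_le_right k n)⟩

/-- The law of the next edge, given that the first `n + 1` edges are `h`, for the start in `x`. -/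
def stepKernel (x : K) (n : ℕ) : Kernel (Finset.Iic n → E) E :=
  Kernel.ofFunOfCountable fun h => M.stepMeasure (M.orbit x (extendWord h) (n + 1))

instance (x : K) (n : ℕ) : IsMarkovKernel (M.stepKernel x n) :=
  ⟨fun h => inferInstanceAs
    (IsProbabilityMeasure (M.stepMeasure (M.orbit x (extendWord h) (n + 1))))⟩

/-- The probability measure `P_x` on the space `ℕ → E` of edge sequences. It is the
measure with `P_x[e_1, …, e_n] = p_{e_1}(x) p_{e_2}(w_{e_1} x) ⋯ p_{e_n}(w_{e_{n-1}} ⋯ w_{e_1} x)`,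
see `pathMeasure_cylinder`. -/
def pathMeasure (x : K) : Measure (ℕ → E) :=
  Kernel.trajMeasure (X := fun _ => E) (M.stepMeasure x) (M.stepKernel x)

instance (x : K) : IsProbabilityMeasure (M.pathMeasure x) :=
  inferInstanceAs (IsProbabilityMeasure
    (Kernel.trajMeasure (X := fun _ => E) (M.stepMeasure x) (M.stepKernel x)))

theorem pathMeasure_cylinder (x : K) (e : ℕ → E) (n : ℕ) :
    M.pathMeasure x {σ | ∀ k < n, σ k = e k} =
      ∏ k ∈ Finset.range n, ENNReal.ofReal (M.p (e k) (M.orbit x e k)) := by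
  cases n with
  | zero => simp
  | succ n =>
    induction n with
    | zero =>
      have h0 : {σ : ℕ → E | ∀ k < 0 + 1, σ k = e k} = (fun σ => σ 0) ⁻¹' {e 0} := by
        ext σ; simp
      have h1 : (M.pathMeasure x).map (Preorder.frestrictLe (π := fun _ => E) 0) =
          (M.stepMeasure x).map
            (MeasurableEquiv.piUnique (fun _ : Finset.Iic 0 => E)).symm := by
        rw [pathMeasure, Kernel.trajMeasure, Measure.map_comp _ _ (by fun_prop),
          Kernel.traj_map_frestrictLe, Kernel.partialTraj_self]
        exact Measure.id_comp
      have h2 := congrArg (fun m : Measure (Finset.Iic 0 → E) => m ((fun h : Finset.Iic 0 → E => h default) ⁻¹' {e 0})) h1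
      beta_reduce at h2
      have hm : MeasurableSet ((fun h : Finset.Iic 0 → E => h default) ⁻¹' {e 0}) :=
        measurable_pi_apply _ (MeasurableSet.singleton _)
      rw [Measure.map_apply (by fun_prop) hm, Measure.map_apply (by fun_prop) hm] at h2
      rw [h0, zero_add, Finset.prod_range_one]
      exact h2.trans (M.stepMeasure_singleton x (e 0))
    | succ n ih =>
      have key := congrArg (fun m : Measure ((Finset.Iic n → E) × E) => m (({fun i : Finset.Iic n => e i} : Set (Finset.Iic n → E)) ×ˢ ({e (n + 1)} : Set E)))
        (Kernel.map_frestrictLe_trajMeasure_compProd_eq_map_trajMeasure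
          (X := fun _ => E) (μ₀ := M.stepMeasure x) (κ := M.stepKernel x) (a := n))
      beta_reduce at key
      rw [Measure.compProd_apply_prod (MeasurableSet.singleton _) (MeasurableSet.singleton _),
        lintegral_singleton, Measure.map_apply (by fun_prop) (MeasurableSet.singleton _),
        Measure.map_apply (by fun_prop)
          ((MeasurableSet.singleton _).prod (MeasurableSet.singleton _))] at key
      have h1 : Preorder.frestrictLe (π := fun _ => E) n ⁻¹' {fun i : Finset.Iic n => e i} =
          {σ : ℕ → E | ∀ k < n + 1, σ k = e k} := by
        ext σ
        simp [funext_iff]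
      have h2 : (fun σ : ℕ → E => (Preorder.frestrictLe (π := fun _ => E) n σ, σ (n + 1))) ⁻¹'
          (({fun i : Finset.Iic n => e i} : Set (Finset.Iic n → E)) ×ˢ ({e (n + 1)} : Set E)) = {σ : ℕ → E | ∀ k < n + 1 + 1, σ k = e k} := by
        ext σ
        simp only [Set.mem_preimage, Set.mem_prod, Set.mem_singleton_iff, Set.mem_ofPred_eq,
          Nat.forall_lt_succ_right (n := n + 1)]
        simp [funext_iff]
      have h3 : M.stepKernel x n (fun i : Finset.Iic n => e i) {e (n + 1)} =
          ENNReal.ofReal (M.p (e (n + 1)) (M.orbit x e (n + 1))) := by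
        change M.stepMeasure (M.orbit x (extendWord fun i : Finset.Iic n => e i) (n + 1)) _ = _
        rw [stepMeasure_singleton, M.orbit_congr x (τ := e)]
        intro k hk
        simp [extendWord, min_eq_left (Nat.lt_succ_iff.1 hk)]
      rw [h1, h2, h3] at key
      rw [Finset.prod_range_succ, ← ih, mul_comm]
      exact key.symm

end PathMeasure

end MarkovSystem

/-! Write `X_k` for the orbit of `x`. The deviations of `f_{σ_k}(X_k)` from `∑ p_e f_e (X_k)` are
orthogonal martingale differences with bounded second moments, so their Cesàro means vanish almost
surely (`ae_tendsto_sub_stepMean`). The function `∑ p_e f_e` is bounded and continuous because the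
pieces of the partition are clopen, and its `μ`-integral is the claimed limit. It therefore suffices
that the empirical measures of the orbit converge weakly to `μ` almost surely
(`ae_tendsto_orbitMean`).

The same law of large numbers, applied to `g ∘ w_e`, makes the empirical measures asymptotically
invariant. By the Feller property every weak cluster point is invariant, hence equal to `μ`, so only
tightness is missing.

For tightness, take a finite set `A 0` meeting every piece and let `A (m + 1)` add to `A m` its
one-step images. If `D_m` is the distance to `A m` within the piece, contractivity bounds the
conditional mean of `D_{m+1}` after one step by `a D_m`. The drift condition controls only first
moments of `D_m`, while the law of large numbers needs second moments. This is why square roots are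
taken: `√D_m` has bounded second moments, and by Jensen it still contracts, with factor `√a`. Its
long-run means are thus at most a constant times `√a ^ m`. Hence, up to an arbitrarily small
proportion, the orbit stays near a finite set (`ae_exists_finite_orbitMean_sqrt_infDist_le`), which
in a complete space is tightness. -/

/-! ### Strong law of large numbers for orthogonal variables -/

/-- The Cesàro means along squares, together with the gaps between squares, control all
Cesàro means. -/
theorem tendsto_cesaro_zero_of_squares {d : ℕ → ℝ}
    (h1 : Tendsto (fun n : ℕ => |∑ k ∈ Finset.range (n ^ 2), d k| / (n : ℝ) ^ 2) atTop (𝓝 0))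
    (h2 : Tendsto (fun n : ℕ => (∑ k ∈ Finset.Ico (n ^ 2) ((n + 1) ^ 2), |d k|) / (n : ℝ) ^ 2)
      atTop (𝓝 0)) :
    Tendsto (fun n : ℕ => (∑ k ∈ Finset.range n, d k) / (n : ℝ)) atTop (𝓝 0) := by
  have hs : Tendsto Nat.sqrt atTop atTop :=
    tendsto_atTop.2 fun b => (eventually_ge_atTop (b ^ 2)).mono fun n hn => Nat.le_sqrt'.2 hn
  have h3 := (h1.add h2).comp hs
  rw [add_zero] at h3
  refine squeeze_zero_norm' ?_ h3
  filter_upwards [eventually_ge_atTop 1] with n hn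
  have hlow : n.sqrt ^ 2 ≤ n := Nat.sqrt_le' n
  have hup : n < (n.sqrt + 1) ^ 2 := Nat.lt_succ_sqrt' n
  have hpos : 0 < n.sqrt := Nat.sqrt_pos.2 hn
  have hpos' : (0 : ℝ) < (n.sqrt : ℝ) ^ 2 := by positivity
  have hlow' : ((n.sqrt : ℝ)) ^ 2 ≤ n := by exact_mod_cast hlow
  simp only [Function.comp, ← add_div, norm_div, Real.norm_eq_abs, Nat.abs_cast]
  refine div_le_div₀ (by positivity) ?_ hpos' hlow'
  rw [← Finset.sum_range_add_sum_Ico d hlow]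
  refine (abs_add_le _ _).trans (add_le_add le_rfl ((Finset.abs_sum_le_sum_abs _ _).trans ?_))
  exact Finset.sum_le_sum_of_subset_of_nonneg
    (Finset.Ico_subset_Ico le_rfl hup.le) fun _ _ _ => abs_nonneg _

/-- The series of the `Y n` has finite integral, so it converges almost surely and its terms vanish.
-/
theorem ae_tendsto_zero_of_integral_le {Ω : Type*} [MeasurableSpace Ω] {P : Measure Ω}
    {Y : ℕ → Ω → ℝ} {c : ℕ → ℝ} (hY : ∀ n, Integrable (Y n) P) (hY0 : ∀ n ω, 0 ≤ Y n ω)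
    (hc : Summable c) (hle : ∀ n, ∫ ω, Y n ω ∂P ≤ c n) :
    ∀ᵐ ω ∂P, Tendsto (fun n => Y n ω) atTop (𝓝 0) := by
  have hc0 : ∀ n, 0 ≤ c n := fun n => (integral_nonneg (hY0 n)).trans (hle n)
  have hm : ∀ n, AEMeasurable (fun ω => ENNReal.ofReal (Y n ω)) P :=
    fun n => (hY n).aemeasurable.ennreal_ofReal
  have hfin : ∫⁻ ω, ∑' n, ENNReal.ofReal (Y n ω) ∂P ≠ ⊤ := by
    rw [lintegral_tsum hm]
    refine ne_top_of_le_ne_top hc.tsum_ofReal_ne_top (ENNReal.tsum_le_tsum fun n => ?_)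
    rw [← ofReal_integral_eq_lintegral_ofReal (hY n) (ae_of_all _ (hY0 n))]
    exact ENNReal.ofReal_le_ofReal (hle n)
  filter_upwards [ae_lt_top' (AEMeasurable.tsum hm) hfin] with ω hω
  have := ENNReal.tendsto_atTop_zero_of_tsum_ne_top hω.ne
  have h2 := (ENNReal.tendsto_toReal ENNReal.zero_ne_top).comp this
  simpa [Function.comp_def, ENNReal.toReal_ofReal (hY0 _ _)] using h2

/-- A strong law of large numbers for orthogonal random variables with bounded second moments. -/
theorem strong_law_of_orthogonal {Ω : Type*} [MeasurableSpace Ω] {P : Measure Ω}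
    {D : ℕ → Ω → ℝ} {C : ℝ} (hD : ∀ k, MemLp (D k) 2 P)
    (horth : ∀ j k, j < k → ∫ ω, D j ω * D k ω ∂P = 0)
    (hC : ∀ k, ∫ ω, D k ω ^ 2 ∂P ≤ C) :
    ∀ᵐ ω ∂P, Tendsto (fun n : ℕ => (∑ k ∈ Finset.range n, D k ω) / (n : ℝ)) atTop (𝓝 0) := by
  have hint : ∀ j k, Integrable (fun ω => D j ω * D k ω) P :=
    fun j k => (hD j).integrable_mul (hD k)
  have hint2 : ∀ k, Integrable (fun ω => D k ω ^ 2) P := fun k => (hD k).integrable_sq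
  have hC0 : 0 ≤ C := (integral_nonneg fun ω => sq_nonneg (D 0 ω)).trans (hC 0)
  have hS : ∀ n, MemLp (fun ω => ∑ k ∈ Finset.range n, D k ω) 2 P :=
    fun n => memLp_finsetSum _ fun k _ => hD k
  -- Orthogonality kills the cross terms, so the second moment grows only linearly.
  have hSn : ∀ n : ℕ, ∫ ω, (∑ k ∈ Finset.range n, D k ω) ^ 2 ∂P ≤ n * C := by
    intro n
    induction n with
    | zero => simp
    | succ n ih =>
      have hcross : ∫ ω, (∑ k ∈ Finset.range n, D k ω) * D n ω ∂P = 0 := by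
        simp only [Finset.sum_mul]
        rw [integral_finsetSum _ fun k _ => hint k n]
        exact Finset.sum_eq_zero fun k hk => horth k n (Finset.mem_range.1 hk)
      have hci : Integrable (fun ω => 2 * ((∑ k ∈ Finset.range n, D k ω) * D n ω)) P :=
        ((hS n).integrable_mul (hD n)).const_mul 2
      have : ∀ ω, (∑ k ∈ Finset.range (n + 1), D k ω) ^ 2 =
          (∑ k ∈ Finset.range n, D k ω) ^ 2 + 2 * ((∑ k ∈ Finset.range n, D k ω) * D n ω) +
            D n ω ^ 2 := by
        intro ω; rw [Finset.sum_range_succ]; ring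
      simp only [this]
      rw [integral_add (show Integrable (fun ω => (∑ k ∈ Finset.range n, D k ω) ^ 2 +
          2 * ((∑ k ∈ Finset.range n, D k ω) * D n ω)) P from (hS n).integrable_sq.add hci)
          (hint2 n), integral_add (hS n).integrable_sq hci, integral_const_mul, hcross]
      push_cast
      linarith [hC n]
  have hT : ∀ s : Finset ℕ, MemLp (fun ω => ∑ k ∈ s, |D k ω|) 2 P :=
    fun s => memLp_finsetSum _ fun k _ => (hD k).abs
  -- Absolute values destroy orthogonality, but Cauchy–Schwarz is enough: the gap after `n ^ 2` has
  -- only `2 * n + 1` terms.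
  have hTn : ∀ s : Finset ℕ, ∫ ω, (∑ k ∈ s, |D k ω|) ^ 2 ∂P ≤ (s.card : ℝ) ^ 2 * C := by
    intro s
    calc ∫ ω, (∑ k ∈ s, |D k ω|) ^ 2 ∂P
        ≤ ∫ ω, s.card * ∑ k ∈ s, D k ω ^ 2 ∂P := by
          refine integral_mono (hT s).integrable_sq
            ((integrable_finsetSum _ fun k _ => hint2 k).const_mul _) fun ω => ?_
          simpa [sq_abs] using sq_sum_le_card_mul_sum_sq (s := s) (f := fun k => |D k ω|)
      _ = s.card * ∑ k ∈ s, ∫ ω, D k ω ^ 2 ∂P := by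
          rw [integral_const_mul, integral_finsetSum _ fun k _ => hint2 k]
      _ ≤ s.card * (s.card * C) := by
          gcongr
          simpa using Finset.sum_le_card_nsmul s _ C fun k _ => hC k
      _ = _ := by ring
  have hsum : Summable fun n : ℕ => C * ((n : ℝ) ^ 2)⁻¹ :=
    (Real.summable_nat_pow_inv.2 one_lt_two).mul_left C
  have root : ∀ {Z : ℕ → ℝ}, (∀ n, 0 ≤ Z n) →
      Tendsto (fun n : ℕ => (Z n) ^ 2 / (n : ℝ) ^ 4) atTop (𝓝 0) →
      Tendsto (fun n : ℕ => Z n / (n : ℝ) ^ 2) atTop (𝓝 0) := by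
    intro Z hZ h
    have h' := (Real.continuous_sqrt.tendsto 0).comp h
    rw [Real.sqrt_zero] at h'
    refine h'.congr fun n => ?_
    have : (Z n) ^ 2 / (n : ℝ) ^ 4 = (Z n / (n : ℝ) ^ 2) ^ 2 := by ring
    simp only [Function.comp]
    rw [this, Real.sqrt_sq (div_nonneg (hZ n) (by positivity))]
  have hY1 : ∀ᵐ ω ∂P, Tendsto (fun n : ℕ =>
      |∑ k ∈ Finset.range (n ^ 2), D k ω| ^ 2 / (n : ℝ) ^ 4) atTop (𝓝 0) := by
    simp only [sq_abs]
    refine ae_tendsto_zero_of_integral_le (fun n => (hS (n ^ 2)).integrable_sq.div_const _)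
      (fun n ω => by positivity) hsum fun n => ?_
    rw [integral_div]
    rcases Nat.eq_zero_or_pos n with rfl | hn
    · simp
    have hn' : (0 : ℝ) < n := by exact_mod_cast hn
    rw [div_le_iff₀ (by positivity)]
    refine (hSn (n ^ 2)).trans (le_of_eq ?_)
    push_cast
    field_simp
  have hY2 : ∀ᵐ ω ∂P, Tendsto (fun n : ℕ =>
      (∑ k ∈ Finset.Ico (n ^ 2) ((n + 1) ^ 2), |D k ω|) ^ 2 / (n : ℝ) ^ 4) atTop (𝓝 0) := by
    -- The factor 9 comes from `(2 * n + 1) ^ 2 ≤ (3 * n) ^ 2` for `n ≥ 1`; at `n = 0` the quotient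
    -- is zero by convention.
    refine ae_tendsto_zero_of_integral_le (fun n => (hT _).integrable_sq.div_const _)
      (fun n ω => by positivity) (hsum.mul_left 9) fun n => ?_
    rw [integral_div]
    rcases Nat.eq_zero_or_pos n with rfl | hn
    · simp
    have hn' : (1 : ℝ) ≤ n := by exact_mod_cast hn
    have hn0 : (0 : ℝ) < n := by linarith
    rw [div_le_iff₀ (by positivity)]
    refine (hTn _).trans ?_
    have hcard : ((Finset.Ico (n ^ 2) ((n + 1) ^ 2)).card : ℝ) = 2 * n + 1 := by
      rw [Nat.card_Ico, show (n + 1) ^ 2 - n ^ 2 = 2 * n + 1 by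
        rw [show (n + 1) ^ 2 = n ^ 2 + (2 * n + 1) by ring]; omega]
      push_cast; ring
    rw [hcard, show 9 * (C * ((n : ℝ) ^ 2)⁻¹) * (n : ℝ) ^ 4 = (3 * n) ^ 2 * C by
      field_simp; ring]
    gcongr
    linarith
  filter_upwards [hY1, hY2] with ω h1 h2
  exact tendsto_cesaro_zero_of_squares (root (fun n => abs_nonneg _) h1)
    (root (fun n => Finset.sum_nonneg fun _ _ => abs_nonneg _) h2)

/-! ### Functions of finitely many edges -/

section DependsOn

variable {E : Type*} [Finite E] [MeasurableSpace E] [DiscreteMeasurableSpace E]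

/-- Such a function factors through the finite discrete space of words of length `n`. Functions of
the orbit at a fixed time are therefore measurable, and real ones bounded, with no measurability
needed on `K`. -/
theorem DependsOn.measurable_of_Iio {β : Type*} [Nonempty β] [MeasurableSpace β] {n : ℕ}
    {F : (ℕ → E) → β} (hF : DependsOn F (Set.Iio n)) : Measurable F := by
  obtain ⟨g, rfl⟩ := dependsOn_iff_exists_comp.1 hF
  exact (Measurable.of_discrete (f := g)).comp (Set.measurable_restrict _)

theorem DependsOn.memLp_of_Iio {n : ℕ} {F : (ℕ → E) → ℝ} (hF : DependsOn F (Set.Iio n))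
    (q : ENNReal) (P : Measure (ℕ → E)) [IsFiniteMeasure P] : MemLp F q P := by
  have hm := hF.measurable_of_Iio
  obtain ⟨g, rfl⟩ := dependsOn_iff_exists_comp.1 hF
  obtain ⟨C, hC⟩ := (Set.finite_range fun c => ‖g c‖).bddAbove
  exact MemLp.of_bound hm.aestronglyMeasurable C (ae_of_all _ fun σ => hC ⟨_, rfl⟩)

theorem DependsOn.integrable_of_Iio {n : ℕ} {F : (ℕ → E) → ℝ} (hF : DependsOn F (Set.Iio n))
    (P : Measure (ℕ → E)) [IsFiniteMeasure P] : Integrable F P :=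
  memLp_one_iff_integrable.1 (hF.memLp_of_Iio 1 P)

end DependsOn

/-! ### Conditional law of the next edge and martingale differences -/

namespace MarkovSystem

variable {K V E : Type*} [MeasurableSpace K] [Fintype E] (M : MarkovSystem K V E)

/-- The mean of `h e y` over the edges `e`, drawn with the probabilities `p_e(y)`. -/
def stepMean (h : E → K → ℝ) (y : K) : ℝ := ∑ e, M.p e y * h e y

theorem dependsOn_orbit (x : K) (n : ℕ) : DependsOn (fun σ => M.orbit x σ n) (Set.Iio n) :=
  fun _ _ h => M.orbit_congr x fun k hk => h k hk

theorem dependsOn_comp_orbit {β : Type*} (x : K) (n : ℕ) (g : K → β) :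
    DependsOn (fun σ : ℕ → E => g (M.orbit x σ n)) (Set.Iio n) :=
  fun _ _ h => congrArg g (M.dependsOn_orbit x n h)

theorem dependsOn_edge_orbit {β : Type*} (x : K) (n : ℕ) (g : E → K → β) :
    DependsOn (fun σ : ℕ → E => g (σ n) (M.orbit x σ n)) (Set.Iio (n + 1)) := by
  intro σ τ h
  have h1 : M.orbit x σ n = M.orbit x τ n :=
    M.orbit_congr x fun k hk => h k (Set.mem_Iio.2 (hk.trans n.lt_succ_self))
  have h2 : σ n = τ n := h n (Set.mem_Iio.2 n.lt_succ_self)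
  simp only [h1, h2]

variable [MeasurableSpace E] [DiscreteMeasurableSpace E]

/-- This is the Markov property, tested on single words: the cylinder probabilities of lengths `n +
1` and `n` differ by the factor `p_e` at the current point. -/
theorem map_restrict_pathMeasure (x : K) (n : ℕ) (e : E) :
    ((M.pathMeasure x).restrict {σ | σ n = e}).map (Set.Iio n).domRestrict =
      ((M.pathMeasure x).withDensity fun σ => ENNReal.ofReal (M.p e (M.orbit x σ n))).map
        (Set.Iio n).domRestrict := by
  have hr : Measurable ((Set.Iio n).domRestrict : (ℕ → E) → _) := Set.measurable_restrict _
  refine Measure.ext_of_singleton fun c => ?_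
  rw [Measure.map_apply hr (measurableSet_singleton c),
    Measure.map_apply hr (measurableSet_singleton c),
    Measure.restrict_apply (hr (measurableSet_singleton c)),
    withDensity_apply _ (hr (measurableSet_singleton c))]
  classical
  -- Continuing `c` by `e` makes both events cylinders around one sequence, of lengths `n` and `n +
  -- 1`.
  set τ : ℕ → E := fun k => if hk : k < n then c ⟨k, hk⟩ else e with hτ
  have h1 : (Set.Iio n).domRestrict ⁻¹' ({c} : Set (Set.Iio n → E)) = {σ : ℕ → E | ∀ k < n, σ k = τ k} := by
    ext σ
    simp only [Set.mem_preimage, Set.mem_singleton_iff, funext_iff, Subtype.forall,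
      Set.domRestrict_apply, Set.mem_ofPred_eq, Set.mem_Iio]
    refine forall₂_congr fun k hk => ?_
    simp [hτ, hk]
  have h2 : (Set.Iio n).domRestrict ⁻¹' ({c} : Set (Set.Iio n → E)) ∩ {σ : ℕ → E | σ n = e} =
      {σ : ℕ → E | ∀ k < n + 1, σ k = τ k} := by
    rw [h1]
    ext σ
    simp only [Set.mem_inter_iff, Set.mem_ofPred_eq, Nat.forall_lt_succ_right]
    simp [hτ]
  have h3 : ∫⁻ σ in (Set.Iio n).domRestrict ⁻¹' ({c} : Set (Set.Iio n → E)), ENNReal.ofReal (M.p e (M.orbit x σ n))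
      ∂(M.pathMeasure x) = ∫⁻ _ in (Set.Iio n).domRestrict ⁻¹' ({c} : Set (Set.Iio n → E)),
        ENNReal.ofReal (M.p e (M.orbit x τ n)) ∂(M.pathMeasure x) := by
    refine setLIntegral_congr_fun (hr (measurableSet_singleton c)) fun σ hσ => ?_
    rw [h1] at hσ
    simp only [M.orbit_congr x hσ]
  rw [h2, h3, setLIntegral_const, h1, M.pathMeasure_cylinder, M.pathMeasure_cylinder,
    Finset.prod_range_succ, mul_comm]
  simp [hτ]

/-- The next edge is chosen with the probabilities `p_e` at the current point of the orbit. -/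
theorem setIntegral_edge_eq (x : K) (n : ℕ) (e : E) {G : (ℕ → E) → ℝ}
    (hG : DependsOn G (Set.Iio n)) :
    ∫ σ in {σ | σ n = e}, G σ ∂(M.pathMeasure x) =
      ∫ σ, M.p e (M.orbit x σ n) * G σ ∂(M.pathMeasure x) := by
  have hr : Measurable ((Set.Iio n).domRestrict : (ℕ → E) → _) := Set.measurable_restrict _
  have hp : Measurable fun σ : ℕ → E => M.p e (M.orbit x σ n) :=
    (M.dependsOn_comp_orbit x n (M.p e)).measurable_of_Iio
  obtain ⟨g, rfl⟩ := dependsOn_iff_exists_comp.1 hG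
  have key := congrArg (fun m => ∫ c, g c ∂m) (M.map_restrict_pathMeasure x n e)
  beta_reduce at key
  rw [integral_map hr.aemeasurable Measurable.of_discrete.aestronglyMeasurable,
    integral_map hr.aemeasurable Measurable.of_discrete.aestronglyMeasurable,
    integral_withDensity_eq_integral_toReal_smul hp.ennreal_ofReal
      (ae_of_all _ fun _ => ENNReal.ofReal_lt_top)] at key
  simpa [ENNReal.toReal_ofReal (M.p_nonneg e _)] using key

theorem integral_edge_eq (x : K) (n : ℕ) {F : (ℕ → E) → E → ℝ}
    (hF : ∀ e, DependsOn (fun σ => F σ e) (Set.Iio n)) :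
    ∫ σ, F σ (σ n) ∂(M.pathMeasure x) =
      ∫ σ, ∑ e, M.p e (M.orbit x σ n) * F σ e ∂(M.pathMeasure x) := by
  classical
  have hms : ∀ e : E, MeasurableSet {σ : ℕ → E | σ n = e} := fun e =>
    (measurable_pi_apply n : Measurable fun σ : ℕ → E => σ n) (measurableSet_singleton e)
  have h1 : ∀ σ : ℕ → E, F σ (σ n) =
      ∑ e, ({σ : ℕ → E | σ n = e}.indicator (fun σ => F σ e)) σ := by
    intro σ
    simp [Set.indicator_apply]
  simp only [h1]
  rw [integral_finsetSum _ fun e _ => ((hF e).integrable_of_Iio _).indicator (hms e),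
    integral_finsetSum]
  · refine Finset.sum_congr rfl fun e _ => ?_
    rw [integral_indicator (hms e), M.setIntegral_edge_eq x n e (hF e)]
  · intro e _
    have : DependsOn (fun σ => M.p e (M.orbit x σ n) * F σ e) (Set.Iio n) := fun σ τ h => by
      simp only [hF e h, M.dependsOn_comp_orbit x n (M.p e) h]
    exact this.integrable_of_Iio _

theorem integral_edge_orbit_eq (x : K) (n : ℕ) (h : E → K → ℝ) :
    ∫ σ, h (σ n) (M.orbit x σ n) ∂(M.pathMeasure x) =
      ∫ σ, M.stepMean h (M.orbit x σ n) ∂(M.pathMeasure x) :=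
  M.integral_edge_eq x n fun e => M.dependsOn_comp_orbit x n (h e)

/-- Almost surely, the orbit stays in the domain of the edge that is taken. -/
theorem ae_orbit_mem_vertexSet (x : K) :
    ∀ᵐ σ ∂(M.pathMeasure x), ∀ n, M.orbit x σ n ∈ M.vertexSet (M.ini (σ n)) := by
  classical
  rw [ae_all_iff]
  intro n
  -- The indicator of leaving the domain has conditional mean zero, since `p_e` vanishes off its
  -- piece.
  set h : E → K → ℝ := fun e y => if y ∈ M.vertexSet (M.ini e) then 0 else 1 with hh
  have h0 : ∀ y, M.stepMean h y = 0 := by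
    intro y
    refine Finset.sum_eq_zero fun e _ => ?_
    by_cases hy : y ∈ M.vertexSet (M.ini e)
    · simp [hh, hy]
    · simp [M.p_eq_zero e y hy]
  have h1 := M.integral_edge_orbit_eq x n h
  simp only [h0, integral_zero] at h1
  have hnn : 0 ≤ fun σ : ℕ → E => h (σ n) (M.orbit x σ n) := fun σ => by
    simp only [hh, Pi.zero_apply]; split_ifs <;> norm_num
  rw [integral_eq_zero_iff_of_nonneg hnn
    ((M.dependsOn_edge_orbit x n h).integrable_of_Iio _)] at h1
  filter_upwards [h1] with σ hσ
  by_contra hne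
  simp [hh, hne] at hσ

/-- The strong law of large numbers for the deviations of functions of the next edge and the
current point of the orbit from their conditional means. -/
theorem ae_tendsto_sub_stepMean (x : K) (h : E → K → ℝ) (C : ℝ)
    (hC : ∀ k, ∫ σ, h (σ k) (M.orbit x σ k) ^ 2 ∂(M.pathMeasure x) ≤ C) :
    ∀ᵐ σ ∂(M.pathMeasure x), Tendsto (fun n : ℕ => (∑ k ∈ Finset.range n,
      (h (σ k) (M.orbit x σ k) - M.stepMean h (M.orbit x σ k))) / (n : ℝ)) atTop (𝓝 0) := by
  have hdep : ∀ k, DependsOn (fun σ : ℕ → E =>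
      h (σ k) (M.orbit x σ k) - M.stepMean h (M.orbit x σ k)) (Set.Iio (k + 1)) :=
    fun k => M.dependsOn_edge_orbit x k fun e y => h e y - M.stepMean h y
  refine strong_law_of_orthogonal (C := C) (fun k => (hdep k).memLp_of_Iio 2 _) ?_ ?_
  · intro j k hjk
    -- The earlier factor is already determined by the first `k` edges, while the later one is
    -- centred given them.
    have := M.integral_edge_eq x k (F := fun σ e =>
      (h (σ j) (M.orbit x σ j) - M.stepMean h (M.orbit x σ j)) *
        (h e (M.orbit x σ k) - M.stepMean h (M.orbit x σ k))) fun e σ τ hστ => by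
        have h1 := (hdep j).mono (Set.Iio_subset_Iio (Nat.succ_le_of_lt hjk)) hστ
        have h2 := M.dependsOn_comp_orbit x k (fun y => h e y - M.stepMean h y) hστ
        simp only at h1 h2 ⊢
        rw [h1, h2]
    rw [this]
    refine integral_eq_zero_of_ae (ae_of_all _ fun σ => ?_)
    simp only [Pi.zero_apply]
    have h3 : ∀ y, ∑ e, M.p e y * (h e y - M.stepMean h y) = 0 := by
      intro y
      simp only [mul_sub, Finset.sum_sub_distrib, ← Finset.sum_mul, M.sum_p]
      simp [stepMean]
    simp only [mul_left_comm (M.p _ _), ← Finset.mul_sum, h3, mul_zero]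
  · intro k
    refine le_trans ?_ (hC k)
    rw [M.integral_edge_orbit_eq x k (fun e y => (h e y - M.stepMean h y) ^ 2),
      M.integral_edge_orbit_eq x k (fun e y => h e y ^ 2)]
    refine integral_mono ((M.dependsOn_comp_orbit x k _).integrable_of_Iio _)
      ((M.dependsOn_comp_orbit x k _).integrable_of_Iio _) fun σ => ?_
    -- A conditional variance is at most the conditional second moment.
    set y := M.orbit x σ k
    have h4 : M.stepMean (fun e y => (h e y - M.stepMean h y) ^ 2) y =
        M.stepMean (fun e y => h e y ^ 2) y - M.stepMean h y ^ 2 := by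
      have : ∀ e, M.p e y * (h e y - M.stepMean h y) ^ 2 = M.p e y * h e y ^ 2 -
          2 * M.stepMean h y * (M.p e y * h e y) + M.p e y * M.stepMean h y ^ 2 := fun e => by ring
      have h5 : ∑ e, M.p e y * h e y = M.stepMean h y := rfl
      conv_lhs => rw [stepMean]
      simp only [this, Finset.sum_add_distrib, Finset.sum_sub_distrib, ← Finset.mul_sum,
        ← Finset.sum_mul, M.sum_p, h5]
      simp only [stepMean]
      ring
    beta_reduce
    rw [h4]
    linarith [sq_nonneg (M.stepMean h y)]

end MarkovSystem

/-! ### Tightness and a countable determining class -/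

section Tightness

variable {K : Type*} [MetricSpace K] [MeasurableSpace K] [BorelSpace K]

theorem exists_finite_measure_infDist_le (ν : Measure K) [IsFiniteMeasure ν] [CompleteSpace K]
    [TopologicalSpace.SeparableSpace K] [Nonempty K] {ε : ℝ} (hε : 0 < ε) :
    ∃ A : Set K, A.Finite ∧ A.Nonempty ∧
      ν {y | ε ≤ Metric.infDist y A} ≤ ENNReal.ofReal ε := by
  have : SecondCountableTopology K := UniformSpace.secondCountable_of_separable K
  obtain ⟨C, hC, hνC⟩ := isTightMeasureSet_iff_exists_isCompact_measure_compl_le.1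
    (isTightMeasureSet_singleton (μ := ν)) _ (ENNReal.ofReal_pos.2 hε)
  obtain ⟨t, -, htf, hCt⟩ := hC.finite_cover_balls hε
  obtain ⟨z⟩ := ‹Nonempty K›
  -- The extra point `z` keeps the set non-empty: `infDist` to the empty set is zero, which would
  -- void the estimates.
  refine ⟨insert z t, htf.insert z, Set.insert_nonempty z t,
    (measure_mono fun y hy => ?_).trans (hνC ν rfl)⟩
  intro hyC
  obtain ⟨a, ha, hya⟩ := Set.mem_iUnion₂.1 (hCt hyC)
  exact absurd ((Metric.infDist_le_dist_of_mem (Set.mem_insert_of_mem z ha)).trans_lt hya)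
    (not_lt.2 hy)

/-- A sequence of finite measures on a complete separable space is tight as soon as, for every
`ε`, all but finitely many of its members are concentrated, up to `ε`, in the `ε`-neighbourhood of
one finite set. -/
theorem isTightMeasureSet_range_of_infDist [CompleteSpace K] [TopologicalSpace.SeparableSpace K]
    [Nonempty K] {ν : ℕ → Measure K} [∀ n, IsFiniteMeasure (ν n)]
    (h : ∀ ε : ℝ, 0 < ε → ∃ A : Set K, A.Finite ∧ A.Nonempty ∧
      ∀ᶠ n in atTop, ν n {y | ε ≤ Metric.infDist y A} ≤ ENNReal.ofReal ε) :
    IsTightMeasureSet (Set.range ν) := by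
  have h' : ∀ ε : ℝ, 0 < ε → ∃ A : Set K, A.Finite ∧ A.Nonempty ∧
      ∀ n, ν n {y | ε ≤ Metric.infDist y A} ≤ ENNReal.ofReal ε := by
    intro ε hε
    obtain ⟨A, hAf, hAn, hA⟩ := h ε hε
    obtain ⟨N, hN⟩ := eventually_atTop.1 hA
    choose B hBf hBn hB using fun n => exists_finite_measure_infDist_le (ν n) hε
    refine ⟨A ∪ ⋃ n ∈ Set.Iio N, B n, hAf.union ((Set.finite_Iio N).biUnion fun n _ => hBf n),
      hAn.mono Set.subset_union_left, fun n => ?_⟩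
    rcases lt_or_ge n N with hn | hn
    · refine (measure_mono fun y (hy : ε ≤ _) => ?_).trans (hB n)
      exact hy.trans (Metric.infDist_le_infDist_of_subset ((Set.subset_biUnion_of_mem
        (u := fun n => B n) (Set.mem_Iio.2 hn)).trans Set.subset_union_right) (hBn n))
    · refine (measure_mono fun y (hy : ε ≤ _) => ?_).trans (hN n hn)
      exact hy.trans (Metric.infDist_le_infDist_of_subset Set.subset_union_left hAn)
  rw [isTightMeasureSet_iff_exists_isCompact_measure_compl_le]
  intro δ hδ
  -- Summability of `ε j` serves twice: the exceptional masses add up to less than `δ`, and `ε j →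
  -- 0` makes the intersection below totally bounded.
  obtain ⟨ε, hε, hsum⟩ := ENNReal.exists_pos_sum_of_countable hδ.ne' ℕ
  choose A hAf hAn hA using fun j => h' (ε j) (hε j)
  refine ⟨⋂ j, {y | Metric.infDist y (A j) ≤ ε j}, ?_, ?_⟩
  · refine TotallyBounded.isCompact_of_isClosed ?_ (isClosed_iInter fun j =>
      isClosed_le (Metric.continuous_infDist_pt _) continuous_const)
    refine Metric.totallyBounded_iff.2 fun r hr => ?_
    obtain ⟨j, hj⟩ := ((ENNReal.tendsto_atTop_zero_of_tsum_ne_top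
      (hsum.trans_le le_top).ne).eventually_lt_const (ENNReal.ofReal_pos.2 hr)).exists
    have hj' : (ε j : ℝ) < r := by
      have := (ENNReal.ofReal_lt_ofReal_iff hr).1
        ((ENNReal.ofReal_coe_nnreal (p := ε j)).trans_lt hj)
      exact this
    refine ⟨A j, hAf j, fun y hy => ?_⟩
    have hy' : Metric.infDist y (A j) < r := (Set.mem_iInter.1 hy j).trans_lt hj'
    obtain ⟨a, ha, hya⟩ := (Metric.infDist_lt_iff (hAn j)).1 hy'
    exact Set.mem_iUnion₂.2 ⟨a, ha, hya⟩
  · rintro _ ⟨n, rfl⟩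
    rw [Set.compl_iInter]
    refine (measure_iUnion_le _).trans (le_trans (ENNReal.tsum_le_tsum fun j => ?_) hsum.le)
    refine (measure_mono fun y hy => ?_).trans ((hA j n).trans_eq ENNReal.ofReal_coe_nnreal)
    simp only [Set.mem_compl_iff, Set.mem_ofPred_eq, not_le] at hy
    exact hy.le

/-- On a separable metric space, countably many bounded continuous functions determine every
finite measure. -/
theorem exists_countable_determining [TopologicalSpace.SeparableSpace K] :
    ∃ g : ℕ → BoundedContinuousFunction K ℝ, ∀ (ν ρ : Measure K) [IsProbabilityMeasure ν]
      [IsProbabilityMeasure ρ], (∀ n, ∫ y, g n y ∂ν = ∫ y, g n y ∂ρ) → ν = ρ := by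
  have : SecondCountableTopology K := UniformSpace.secondCountable_of_separable K
  -- Complements of finite unions of basic open sets form a countable π-system of closed sets
  -- generating the Borel sets; thickened indicators recover their measures.
  set S : Set (Set (Set K)) := {s | s ⊆ TopologicalSpace.countableBasis K ∧ s.Finite} with hS
  have hScount : S.Countable := by
    have := Set.countable_ofPred_finite_subset (TopologicalSpace.countable_countableBasis K)
    exact this.mono fun s (hs : s ⊆ _ ∧ s.Finite) => And.symm hs
  have hSne : S.Nonempty := ⟨∅, Set.empty_subset _, Set.finite_empty⟩
  obtain ⟨s, hs⟩ := hScount.exists_eq_range hSne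
  have hsS : ∀ i, s i ∈ S := fun i => hs ▸ Set.mem_range_self i
  have hcl : ∀ i, IsClosed (⋃₀ s i)ᶜ := fun i => (isOpen_sUnion fun t ht =>
    TopologicalSpace.isOpen_of_mem_countableBasis ((hsS i).1 ht)).isClosed_compl
  have hpos : ∀ j : ℕ, (0 : ℝ) < 1 / ((j : ℝ) + 1) := fun j => by positivity
  have hbd : ∀ i j : ℕ, ∀ y, ‖((thickenedIndicator (hpos j) (⋃₀ s i)ᶜ y : NNReal) : ℝ)‖ ≤ 1 := by
    intro i j y
    rw [Real.norm_of_nonneg (NNReal.coe_nonneg _)]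
    exact_mod_cast thickenedIndicator_le_one (hpos j) _ y
  refine ⟨fun n => BoundedContinuousFunction.ofNormedAddCommGroup
    (fun y => ((thickenedIndicator (hpos n.unpair.2) (⋃₀ s n.unpair.1)ᶜ y : NNReal) : ℝ))
    (by fun_prop) 1 (hbd _ _), fun ν ρ _ _ hνρ => ?_⟩
  have hC : ∀ i, ν (⋃₀ s i)ᶜ = ρ (⋃₀ s i)ᶜ := by
    intro i
    have h1 := tendsto_integral_thickenedIndicator_of_isClosed ν (hcl i) hpos
      tendsto_one_div_add_atTop_nhds_zero_nat
    have h2 := tendsto_integral_thickenedIndicator_of_isClosed ρ (hcl i) hpos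
      tendsto_one_div_add_atTop_nhds_zero_nat
    have h3 := tendsto_nhds_unique (h1.congr fun j => by
      simpa using hνρ (Nat.pair i j)) h2
    exact (measureReal_eq_measureReal_iff (measure_ne_top _ _) (measure_ne_top _ _)).1 h3
  have hgen : ‹MeasurableSpace K› =
      MeasurableSpace.generateFrom (Set.range fun i => (⋃₀ s i)ᶜ) := by
    apply le_antisymm
    · refine (BorelSpace.measurable_eq.trans
        (TopologicalSpace.isBasis_countableBasis K).borel_eq_generateFrom).trans_le ?_
      refine MeasurableSpace.generateFrom_le fun t ht => ?_
      obtain ⟨i, hi⟩ : {t} ∈ Set.range s := hs ▸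
        ⟨Set.singleton_subset_iff.2 ht, Set.finite_singleton t⟩
      have := MeasurableSpace.measurableSet_generateFrom
        (s := Set.range fun i => (⋃₀ s i)ᶜ) ⟨i, rfl⟩
      simp only [hi, Set.sUnion_singleton] at this
      exact this.of_compl
    · refine MeasurableSpace.generateFrom_le ?_
      rintro _ ⟨i, rfl⟩
      exact (hcl i).measurableSet
  refine ext_of_generate_finite _ hgen ?_ ?_ (by simp)
  · rintro _ ⟨i, rfl⟩ _ ⟨j, rfl⟩ -
    obtain ⟨k, hk⟩ : s i ∪ s j ∈ Set.range s := hs ▸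
      ⟨Set.union_subset (hsS i).1 (hsS j).1, (hsS i).2.union (hsS j).2⟩
    exact ⟨k, by simp [hk, Set.sUnion_union]⟩
  · rintro _ ⟨i, rfl⟩
    exact hC i

end Tightness

/-! ### Empirical measures -/

section Empirical

variable {K : Type*} [MeasurableSpace K]

/-- The uniform distribution on the first `n + 1` points of a sequence. -/
noncomputable def empiricalMeasure (X : ℕ → K) (n : ℕ) : Measure K :=
  ((n : ENNReal) + 1)⁻¹ • ∑ k ∈ Finset.range (n + 1), Measure.dirac (X k)

instance (X : ℕ → K) (n : ℕ) : IsProbabilityMeasure (empiricalMeasure X n) := by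
  constructor
  simp only [empiricalMeasure, Measure.smul_apply, Measure.coe_finsetSum, Finset.sum_apply,
    measure_univ, Finset.sum_const, Finset.card_range, smul_eq_mul, nsmul_eq_mul, mul_one]
  push_cast
  exact ENNReal.inv_mul_cancel (by simp) (by finiteness)

theorem integrable_empiricalMeasure [MeasurableSingletonClass K] (X : ℕ → K) (n : ℕ)
    (g : K → ℝ) : Integrable g (empiricalMeasure X n) := by
  refine Integrable.smul_measure ?_ (by simp)
  exact integrable_finsetSum_measure.2 fun k _ => integrable_dirac (by finiteness)

theorem integral_empiricalMeasure [MeasurableSingletonClass K] (X : ℕ → K) (n : ℕ)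
    (g : K → ℝ) :
    ∫ y, g y ∂(empiricalMeasure X n) =
      (∑ k ∈ Finset.range (n + 1), g (X k)) / ((n + 1 : ℕ) : ℝ) := by
  rw [empiricalMeasure, integral_smul_measure,
    integral_finsetSum_measure fun k _ => integrable_dirac (by finiteness)]
  simp only [integral_dirac, smul_eq_mul, ENNReal.toReal_inv]
  rw [div_eq_inv_mul]
  congr 2
  norm_cast

end Empirical

/-! ### Pieces of the partition and finite sets meeting them -/

namespace MarkovSystem

section Cells

variable {K V E : Type*} [MeasurableSpace K] [Fintype E] (M : MarkovSystem K V E)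

theorem exists_mem_vertexSet (y : K) : ∃ v, y ∈ M.vertexSet v :=
  Set.mem_iUnion.1 (M.iUnion_vertexSet ▸ Set.mem_univ y)

theorem vertex_unique {y : K} {v v' : V} (h : y ∈ M.vertexSet v) (h' : y ∈ M.vertexSet v') :
    v = v' := by
  by_contra hne
  exact Set.disjoint_left.1 (M.vertexSet_disjoint hne) h h'

/-- The probabilities sum to one at a point of the piece, so some edge starts there. Hypotheses
indexed by edges thus cover every vertex. -/
theorem exists_ini_eq (v : V) : ∃ e, M.ini e = v := by
  obtain ⟨y, hy⟩ := M.vertexSet_nonempty v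
  by_contra! h
  have : ∑ e, M.p e y = 0 := Finset.sum_eq_zero fun e _ =>
    M.p_eq_zero e y fun hye => h e (M.vertex_unique hye hy)
  rw [M.sum_p] at this
  exact one_ne_zero this

theorem finite_vertices (M : MarkovSystem K V E) : Finite V := Finite.of_surjective M.ini M.exists_ini_eq

/-- The member of the partition that contains `y`. -/
def cell (y : K) : Set K := {z | ∀ v, y ∈ M.vertexSet v → z ∈ M.vertexSet v}

theorem cell_eq {y : K} {v : V} (hy : y ∈ M.vertexSet v) : M.cell y = M.vertexSet v := by
  ext z
  refine ⟨fun h => h v hy, fun hz v' hv' => ?_⟩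
  rwa [M.vertex_unique hv' hy]

theorem stepMean_le_stepMean {h h' : E → K → ℝ} {y : K}
    (hle : ∀ e, y ∈ M.vertexSet (M.ini e) → h e y ≤ h' e y) :
    M.stepMean h y ≤ M.stepMean h' y := by
  refine Finset.sum_le_sum fun e _ => ?_
  by_cases hy : y ∈ M.vertexSet (M.ini e)
  · exact mul_le_mul_of_nonneg_left (hle e hy) (M.p_nonneg e y)
  · simp [M.p_eq_zero e y hy]

/-- Jensen's inequality for the concave square root; it turns a contraction factor `a` into `√a`. -/
theorem stepMean_sqrt_le {h : E → K → ℝ} (h0 : ∀ e y, 0 ≤ h e y) (y : K) :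
    M.stepMean (fun e y => √(h e y)) y ≤ √(M.stepMean h y) :=
  Real.strictConcaveOn_sqrt.concaveOn.le_map_sum (fun e _ => M.p_nonneg e y) (M.sum_p y)
    fun e _ => h0 e y

/-- `A` has a point in every member of the partition. -/
def Meets (A : Set K) : Prop := ∀ v, (A ∩ M.vertexSet v).Nonempty

theorem exists_finite_meets : ∃ A : Set K, A.Finite ∧ M.Meets A := by
  have := M.finite_vertices
  choose z hz using M.vertexSet_nonempty
  exact ⟨Set.range z, Set.finite_range z, fun v => ⟨z v, ⟨v, rfl⟩, hz v⟩⟩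

/-- The points of `A` and their images under one step of the system. -/
def stepSet (A : Set K) : Set K := A ∪ ⋃ e, M.w e '' (A ∩ M.vertexSet (M.ini e))

theorem subset_stepSet (A : Set K) : A ⊆ M.stepSet A := Set.subset_union_left

theorem stepSet_finite {A : Set K} (hA : A.Finite) : (M.stepSet A).Finite :=
  hA.union (Set.finite_iUnion fun _ => (hA.inter_of_left _).image _)

variable {M} in
theorem Meets.mono {A B : Set K} (hA : M.Meets A) (h : A ⊆ B) : M.Meets B :=
  fun v => (hA v).mono (Set.inter_subset_inter_left _ h)

variable {M} in
theorem Meets.inter_cell_nonempty {A : Set K} (hA : M.Meets A) (y : K) : (A ∩ M.cell y).Nonempty := by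
  obtain ⟨v, hv⟩ := M.exists_mem_vertexSet y
  rw [M.cell_eq hv]
  exact hA v

end Cells

/-! ### Drift and time averages along orbits -/

section Orbit

variable {K V E : Type*} [MeasurableSpace K] [Fintype E] [MeasurableSpace E]
  [DiscreteMeasurableSpace E] (M : MarkovSystem K V E)

theorem integrable_comp_orbit (x : K) (k : ℕ) (g : K → ℝ) :
    Integrable (fun σ => g (M.orbit x σ k)) (M.pathMeasure x) :=
  (M.dependsOn_comp_orbit x k g).integrable_of_Iio _

variable {M} in
-- Iterating the drift inequality gives a geometric series; `b / (1 - a)` is the fixed point of `t ↦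
-- a * t + b`.
theorem integral_comp_orbit_le {D : K → ℝ} {a b : ℝ} (ha0 : 0 ≤ a) (ha1 : a < 1) (hb : 0 ≤ b)
    (hD : ∀ y, 0 ≤ D y) (hstep : ∀ y, M.stepMean (fun e y => D (M.w e y)) y ≤ a * D y + b)
    (x : K) (k : ℕ) : ∫ σ, D (M.orbit x σ k) ∂(M.pathMeasure x) ≤ D x + b / (1 - a) := by
  have h1a : 0 < 1 - a := by linarith
  induction k with
  | zero =>
    simp only [orbit, integral_const, probReal_univ, smul_eq_mul, one_mul]
    linarith [div_nonneg hb h1a.le]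
  | succ k ih =>
    have h1 := M.integral_edge_orbit_eq x k fun e y => D (M.w e y)
    simp only [orbit]
    rw [h1]
    calc ∫ σ, M.stepMean (fun e y => D (M.w e y)) (M.orbit x σ k) ∂(M.pathMeasure x)
        ≤ ∫ σ, (a * D (M.orbit x σ k) + b) ∂(M.pathMeasure x) :=
          integral_mono (M.integrable_comp_orbit x k _)
            (M.integrable_comp_orbit x k fun y => a * D y + b) fun σ => hstep _
      _ = a * ∫ σ, D (M.orbit x σ k) ∂(M.pathMeasure x) + b := by
          rw [integral_add ((M.integrable_comp_orbit x k D).const_mul a) (integrable_const b),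
            integral_const_mul]
          simp
      _ ≤ a * (D x + b / (1 - a)) + b := by gcongr
      _ = a * D x + b / (1 - a) := by field_simp; ring
      _ ≤ D x + b / (1 - a) := by nlinarith [hD x]

/-- The mean of `W` along the first `n` points of the orbit. -/
noncomputable def orbitMean (x : K) (W : K → ℝ) (σ : ℕ → E) (n : ℕ) : ℝ :=
  (∑ k ∈ Finset.range n, W (M.orbit x σ k)) / (n : ℝ)

variable {M} in
/-- A one-step upper bound passes to the means along orbits. -/
theorem ae_orbitMean_le {W H : K → ℝ} (hW : ∀ y, 0 ≤ W y)
    (hH : ∀ y, M.stepMean (fun e y => W (M.w e y)) y ≤ H y) (x : K) {C : ℝ}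
    (hC : ∀ k, ∫ σ, W (M.orbit x σ k) ^ 2 ∂(M.pathMeasure x) ≤ C) :
    ∀ᵐ σ ∂(M.pathMeasure x), ∀ ε : ℝ, 0 < ε →
      ∀ᶠ n in atTop, M.orbitMean x W σ n ≤ M.orbitMean x H σ n + ε := by
  filter_upwards [M.ae_tendsto_sub_stepMean x (fun e y => W (M.w e y)) C
    fun k => hC (k + 1)] with σ hσ ε hε
  -- The law of large numbers concerns the shifted points `X_{k+1}`; undoing the shift costs at most
  -- `W x / n`.
  have h1 := hσ.add (tendsto_const_div_atTop_nhds_zero_nat (W x))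
  rw [add_zero] at h1
  filter_upwards [h1.eventually_lt_const hε] with n hn
  have h2 : ∑ k ∈ Finset.range n, W (M.orbit x σ k) ≤
      W x + ∑ k ∈ Finset.range n, W (M.w (σ k) (M.orbit x σ k)) := by
    have := Finset.sum_range_succ' (fun k => W (M.orbit x σ k)) n
    rw [Finset.sum_range_succ] at this
    simp only [orbit] at this
    linarith [hW (M.orbit x σ n)]
  have h3 : ∑ k ∈ Finset.range n, M.stepMean (fun e y => W (M.w e y)) (M.orbit x σ k) ≤
      ∑ k ∈ Finset.range n, H (M.orbit x σ k) := Finset.sum_le_sum fun k _ => hH _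
  rw [Finset.sum_sub_distrib] at hn
  have hn0 : (0 : ℝ) ≤ n := n.cast_nonneg
  have h4 : M.orbitMean x W σ n ≤
      (W x + ∑ k ∈ Finset.range n, W (M.w (σ k) (M.orbit x σ k))) / n :=
    div_le_div_of_nonneg_right h2 hn0
  have h5 := div_le_div_of_nonneg_right h3 hn0
  rw [sub_div] at hn
  rw [add_div] at h4
  unfold orbitMean at *
  linarith

end Orbit

/-! ### Contraction towards finite sets -/

noncomputable section Contraction

variable {K V E : Type*} [MetricSpace K] [MeasurableSpace K] [Fintype E]
  (M : MarkovSystem K V E)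

/-- The distance from `y` to the points of `A` in the same member of the partition. -/
def cellDist (A : Set K) (y : K) : ℝ := Metric.infDist y (A ∩ M.cell y)

theorem cellDist_nonneg (A : Set K) (y : K) : 0 ≤ M.cellDist A y := Metric.infDist_nonneg

variable {M} {A : Set K}

theorem Meets.infDist_le_cellDist (hA : M.Meets A) (y : K) :
    Metric.infDist y A ≤ M.cellDist A y :=
  Metric.infDist_le_infDist_of_subset Set.inter_subset_left (hA.inter_cell_nonempty y)

theorem Meets.cellDist_stepSet_le (hA : M.Meets A) (y : K) :
    M.cellDist (M.stepSet A) y ≤ M.cellDist A y :=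
  Metric.infDist_le_infDist_of_subset (Set.inter_subset_inter_left _ (M.subset_stepSet A))
    (hA.inter_cell_nonempty y)

theorem exists_cellDist_eq (hA : M.Meets A) (hAf : A.Finite) (y : K) :
    ∃ z ∈ A, z ∈ M.cell y ∧ M.cellDist A y = dist y z := by
  obtain ⟨z, hz, h⟩ := (hAf.inter_of_left (M.cell y)).isCompact.exists_infDist_eq_dist
    (hA.inter_cell_nonempty y) y
  exact ⟨z, hz.1, hz.2, h⟩

theorem stepMean_dist_le {a : ℝ} (ha : ∀ e, ∀ x ∈ M.vertexSet (M.ini e),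
      ∀ y ∈ M.vertexSet (M.ini e), ∑ e', M.p e' x * dist (M.w e' x) (M.w e' y) ≤ a * dist x y)
    {y z : K} (hz : z ∈ M.cell y) :
    M.stepMean (fun e y => dist (M.w e y) (M.w e z)) y ≤ a * dist y z := by
  obtain ⟨v, hv⟩ := M.exists_mem_vertexSet y
  obtain ⟨e, rfl⟩ := M.exists_ini_eq v
  exact ha e y hv z (hz _ hv)

/-- Passing from `A` to `stepSet A`, the mean distance contracts. -/
theorem stepMean_cellDist_stepSet_le {a : ℝ} (ha : ∀ e, ∀ x ∈ M.vertexSet (M.ini e),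
      ∀ y ∈ M.vertexSet (M.ini e), ∑ e', M.p e' x * dist (M.w e' x) (M.w e' y) ≤ a * dist x y)
    (hA : M.Meets A) (hAf : A.Finite) (y : K) :
    M.stepMean (fun e y => M.cellDist (M.stepSet A) (M.w e y)) y ≤ a * M.cellDist A y := by
  obtain ⟨z, hzA, hz, h⟩ := exists_cellDist_eq hA hAf y
  rw [h]
  refine le_trans (M.stepMean_le_stepMean fun e hy => ?_) (stepMean_dist_le ha hz)
  refine Metric.infDist_le_dist_of_mem ⟨Or.inr ?_, ?_⟩
  · exact Set.mem_iUnion.2 ⟨e, z, ⟨hzA, hz _ hy⟩, rfl⟩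
  · rw [M.cell_eq (M.mapsTo_w e hy)]
    exact M.mapsTo_w e (hz _ hy)

/-- The drift condition for the distance to a fixed finite set. -/
theorem exists_stepMean_cellDist_le {a : ℝ} (ha : ∀ e, ∀ x ∈ M.vertexSet (M.ini e),
      ∀ y ∈ M.vertexSet (M.ini e), ∑ e', M.p e' x * dist (M.w e' x) (M.w e' y) ≤ a * dist x y)
    (hA : M.Meets A) (hAf : A.Finite) :
    ∃ b, 0 ≤ b ∧ ∀ y,
      M.stepMean (fun e y => M.cellDist A (M.w e y)) y ≤ a * M.cellDist A y + b := by
  -- The additive constant is a bound for the finitely many distances from the images of `A` to `A`.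
  obtain ⟨b, hb⟩ := ((Set.finite_univ (α := E)).image2
    (fun e z => M.cellDist A (M.w e z)) hAf).bddAbove
  refine ⟨max b 0, le_max_right _ _, fun y => ?_⟩
  obtain ⟨z, hzA, hz, h⟩ := exists_cellDist_eq hA hAf y
  have h1 : M.stepMean (fun e y => M.cellDist A (M.w e y)) y ≤
      M.stepMean (fun e y => dist (M.w e y) (M.w e z) + max b 0) y := by
    refine M.stepMean_le_stepMean fun e hy => ?_
    have hc : M.cell (M.w e y) = M.cell (M.w e z) := by
      rw [M.cell_eq (M.mapsTo_w e hy), M.cell_eq (M.mapsTo_w e (hz _ hy))]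
    have hbz : M.cellDist A (M.w e z) ≤ b := hb ⟨e, Set.mem_univ e, z, hzA, rfl⟩
    have := Metric.infDist_le_infDist_add_dist (s := A ∩ M.cell (M.w e y))
      (x := M.w e y) (y := M.w e z)
    rw [hc] at this
    have hle : M.cellDist A (M.w e y) ≤ M.cellDist A (M.w e z) + dist (M.w e y) (M.w e z) := by
      rw [cellDist, hc]
      exact this
    linarith [le_max_left b 0]
  refine h1.trans ?_
  have h2 : M.stepMean (fun e y => dist (M.w e y) (M.w e z) + max b 0) y =
      M.stepMean (fun e y => dist (M.w e y) (M.w e z)) y + max b 0 := by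
    simp only [stepMean, mul_add, Finset.sum_add_distrib, ← Finset.sum_mul, M.sum_p, one_mul]
  rw [h2, h]
  gcongr
  exact stepMean_dist_le ha hz

variable [MeasurableSpace E] [DiscreteMeasurableSpace E]

/-- Almost surely, most points of the orbit are close to a finite set. -/
theorem ae_exists_finite_orbitMean_sqrt_infDist_le (hcontr : M.IsContractive) (x : K) :
    ∀ᵐ σ ∂(M.pathMeasure x), ∀ ε : ℝ, 0 < ε → ∃ A : Set K, A.Finite ∧ A.Nonempty ∧
      ∀ᶠ n in atTop, M.orbitMean x (fun y => √(Metric.infDist y A)) σ n ≤ ε := by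
  obtain ⟨a, ha0, ha1, ha⟩ := hcontr
  obtain ⟨A₀, hA₀f, hA₀⟩ := M.exists_finite_meets
  obtain ⟨b, hb, hbstep⟩ := exists_stepMean_cellDist_le ha hA₀ hA₀f
  set A : ℕ → Set K := fun m => M.stepSet^[m] A₀ with hAdef
  have hAs : ∀ m, A (m + 1) = M.stepSet (A m) := fun m => Function.iterate_succ_apply' _ _ _
  have hA : ∀ m, M.Meets (A m) ∧ (A m).Finite := by
    intro m
    induction m with
    | zero => exact ⟨hA₀, hA₀f⟩
    | succ m ih =>
      rw [hAs]
      exact ⟨ih.1.mono (M.subset_stepSet _), M.stepSet_finite ih.2⟩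
  have hle : ∀ m y, M.cellDist (A m) y ≤ M.cellDist A₀ y := by
    intro m y
    induction m with
    | zero => exact le_rfl
    | succ m ih =>
      rw [hAs]
      exact ((hA m).1.cellDist_stepSet_le y).trans ih
  -- The second moment of the square root is a first moment of the distance, dominated for all `m`
  -- by the drift bound for `A₀`.
  have hC : ∀ m k, ∫ σ, √(M.cellDist (A m) (M.orbit x σ k)) ^ 2 ∂(M.pathMeasure x) ≤
      M.cellDist A₀ x + b / (1 - a) := by
    intro m k
    refine le_trans ?_ (integral_comp_orbit_le ha0.le ha1 hb (M.cellDist_nonneg A₀) hbstep x k)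
    refine integral_mono (M.integrable_comp_orbit x k fun y => √(M.cellDist (A m) y) ^ 2)
      (M.integrable_comp_orbit x k _) fun σ => ?_
    simp only [Real.sq_sqrt (M.cellDist_nonneg _ _)]
    exact hle m _
  set q := √a with hq
  have hq0 : 0 ≤ q := Real.sqrt_nonneg a
  have hq1 : q < 1 := by rw [hq, Real.sqrt_lt' one_pos]; simpa using ha1
  have hbase : ∀ᵐ σ ∂(M.pathMeasure x), ∀ ε : ℝ, 0 < ε → ∀ᶠ n in atTop,
      M.orbitMean x (fun y => √(M.cellDist (A 0) y)) σ n ≤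
        M.orbitMean x (fun y => q * √(M.cellDist (A 0) y) + √b) σ n + ε := by
    refine ae_orbitMean_le (fun y => Real.sqrt_nonneg _) (fun y => ?_) x (hC 0)
    refine (M.stepMean_sqrt_le (fun e y => M.cellDist_nonneg _ (M.w e y)) y).trans ?_
    refine (Real.sqrt_le_sqrt (hbstep y)).trans ?_
    refine Real.sqrt_le_iff.2 ⟨by positivity, ?_⟩
    have e1 : q ^ 2 = a := Real.sq_sqrt ha0.le
    have e2 := Real.sq_sqrt (M.cellDist_nonneg (A 0) y)
    have e3 := Real.sq_sqrt hb
    have e4 : 0 ≤ q * √(M.cellDist (A 0) y) * √b := by positivity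
    change a * M.cellDist (A 0) y + b ≤ _
    calc a * M.cellDist (A 0) y + b = q ^ 2 * √(M.cellDist (A 0) y) ^ 2 + √b ^ 2 := by
          rw [e1, e2, e3]
      _ ≤ _ := by nlinarith
  have hsucc : ∀ᵐ σ ∂(M.pathMeasure x), ∀ m, ∀ ε : ℝ, 0 < ε → ∀ᶠ n in atTop,
      M.orbitMean x (fun y => √(M.cellDist (A (m + 1)) y)) σ n ≤
        M.orbitMean x (fun y => q * √(M.cellDist (A m) y)) σ n + ε := by
    rw [ae_all_iff]
    intro m
    refine ae_orbitMean_le (fun y => Real.sqrt_nonneg _) (fun y => ?_) x (hC (m + 1))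
    refine (M.stepMean_sqrt_le (fun e y => M.cellDist_nonneg _ (M.w e y)) y).trans ?_
    rw [hq, ← Real.sqrt_mul ha0.le, hAs]
    exact Real.sqrt_le_sqrt (stepMean_cellDist_stepSet_le ha (hA m).1 (hA m).2 y)
  have hmul : ∀ σ n m, M.orbitMean x (fun y => q * √(M.cellDist (A m) y)) σ n =
      q * M.orbitMean x (fun y => √(M.cellDist (A m) y)) σ n := by
    intro σ n m
    simp only [orbitMean, ← Finset.mul_sum, mul_div_assoc]
  filter_upwards [hbase, hsucc] with σ h0 hs ε hε
  -- With error 1, the base inequality bounds the mean by `q` times itself plus `√b + 1`; solving it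
  -- gives `B`.
  set B := (√b + 1) / (1 - q) with hB
  have hq1' : 0 < 1 - q := by linarith
  have hB0 : 0 ≤ B := by positivity
  have hind : ∀ m, ∀ δ : ℝ, 0 < δ → ∀ᶠ n in atTop,
      M.orbitMean x (fun y => √(M.cellDist (A m) y)) σ n ≤ q ^ m * B + δ := by
    intro m
    induction m with
    | zero =>
      intro δ hδ
      filter_upwards [h0 1 one_pos, eventually_ge_atTop 1] with n hn hn1
      have hn0 : (n : ℝ) ≠ 0 := by positivity
      have e : M.orbitMean x (fun y => q * √(M.cellDist (A 0) y) + √b) σ n =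
          q * M.orbitMean x (fun y => √(M.cellDist (A 0) y)) σ n + √b := by
        rw [← hmul]
        simp only [orbitMean, Finset.sum_add_distrib, add_div]
        simp [hn0]
      rw [e] at hn
      have : M.orbitMean x (fun y => √(M.cellDist (A 0) y)) σ n ≤ B := by
        rw [hB, le_div_iff₀ hq1']
        linarith
      rw [pow_zero, one_mul]
      linarith
    | succ m ih =>
      intro δ hδ
      filter_upwards [ih (δ / 2) (by positivity), hs m (δ / 2) (by positivity)] with n h1 h2
      rw [hmul] at h2
      have h3 := mul_le_mul_of_nonneg_left h1 hq0
      have h4 : q * (δ / 2) ≤ δ / 2 := mul_le_of_le_one_left (by positivity) hq1.le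
      calc _ ≤ _ := h2
        _ ≤ q * (q ^ m * B + δ / 2) + δ / 2 := by gcongr
        _ = q ^ (m + 1) * B + (q * (δ / 2) + δ / 2) := by ring
        _ ≤ _ := by linarith
  have hlim : Tendsto (fun m => q ^ m * B) atTop (𝓝 0) := by
    simpa using (tendsto_pow_atTop_nhds_zero_of_lt_one hq0 hq1).mul_const B
  obtain ⟨m, hm⟩ := (hlim.eventually_lt_const (half_pos hε)).exists
  have hAne : (A m).Nonempty := ((hA m).1.inter_cell_nonempty x).mono Set.inter_subset_left
  refine ⟨A m, (hA m).2, hAne, ?_⟩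
  filter_upwards [hind m (ε / 2) (half_pos hε)] with n hn
  have : M.orbitMean x (fun y => √(Metric.infDist y (A m))) σ n ≤
      M.orbitMean x (fun y => √(M.cellDist (A m) y)) σ n :=
    div_le_div_of_nonneg_right (Finset.sum_le_sum fun k _ =>
      Real.sqrt_le_sqrt ((hA m).1.infDist_le_cellDist _)) n.cast_nonneg
  linarith

end Contraction

end MarkovSystem

/-! ### Feller property and weak convergence of the empirical measures -/

namespace MarkovSystem

noncomputable section Feller

variable {K V E : Type*} [MetricSpace K] [MeasurableSpace K] [Fintype E]
  {M : MarkovSystem K V E}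

theorem IsRegular.isClosed_vertexSet (hreg : M.IsRegular) (e : E) :
    IsClosed (M.vertexSet (M.ini e)) := by
  have : (M.vertexSet (M.ini e))ᶜ = ⋃ e' ∈ {e' | M.ini e' ≠ M.ini e}, M.vertexSet (M.ini e') := by
    ext y
    simp only [Set.mem_compl_iff, Set.mem_iUnion, Set.mem_ofPred_eq, exists_prop]
    constructor
    · intro hy
      obtain ⟨v, hv⟩ := M.exists_mem_vertexSet y
      obtain ⟨e', rfl⟩ := M.exists_ini_eq v
      exact ⟨e', fun h => hy (h ▸ hv), hv⟩
    · rintro ⟨e', hne, hy⟩ hy'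
      exact hne (M.vertex_unique hy hy')
  rw [← isOpen_compl_iff, this]
  exact isOpen_biUnion fun e' _ => hreg.isOpen_vertexSet e'

/-- The piece is clopen, so extension by zero creates no discontinuity at its boundary. -/
theorem IsRegular.continuous_of_continuousOn (hreg : M.IsRegular) {e : E} {h : K → ℝ}
    (hc : ContinuousOn h (M.vertexSet (M.ini e))) (h0 : ∀ y ∉ M.vertexSet (M.ini e), h y = 0) :
    Continuous h := by
  rw [continuous_iff_continuousAt]
  intro y
  by_cases hy : y ∈ M.vertexSet (M.ini e)
  · exact hc.continuousAt ((hreg.isOpen_vertexSet e).mem_nhds hy)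
  · have : h =ᶠ[𝓝 y] fun _ => 0 := by
      filter_upwards [(hreg.isClosed_vertexSet e).isOpen_compl.mem_nhds hy] with z hz
      exact h0 z hz
    exact continuousAt_const.congr this.symm

/-- The Feller property: conditional means of bounded continuous functions are bounded and
continuous. -/
theorem IsRegular.exists_boundedContinuous_stepMean (hreg : M.IsRegular) {h : E → K → ℝ}
    (hc : ∀ e, ContinuousOn (h e) (M.vertexSet (M.ini e)))
    (hb : ∀ e, ∃ C, ∀ y ∈ M.vertexSet (M.ini e), |h e y| ≤ C) :
    ∃ G : BoundedContinuousFunction K ℝ, ∀ y, G y = M.stepMean h y := by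
  choose C hC using hb
  have hcont : Continuous (M.stepMean h) := by
    refine continuous_finsetSum _ fun e _ =>
      hreg.continuous_of_continuousOn ((hreg.continuousOn_p e).mul (hc e)) fun y hy => ?_
    rw [M.p_eq_zero e y hy, zero_mul]
  refine ⟨BoundedContinuousFunction.ofNormedAddCommGroup (M.stepMean h) hcont (∑ e, |C e|)
    fun y => ?_, fun y => rfl⟩
  refine (norm_sum_le _ _).trans (Finset.sum_le_sum fun e _ => ?_)
  by_cases hy : y ∈ M.vertexSet (M.ini e)
  · have hp1 : M.p e y ≤ 1 := by
      rw [← M.sum_p y]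
      exact Finset.single_le_sum (fun e _ => M.p_nonneg e y) (Finset.mem_univ e)
    rw [Real.norm_eq_abs, abs_mul, abs_of_nonneg (M.p_nonneg e y)]
    exact (mul_le_of_le_one_left (abs_nonneg _) hp1).trans
      ((hC e y hy).trans (le_abs_self _))
  · simp [M.p_eq_zero e y hy]

theorem IsRegular.exists_boundedContinuous_markovOp (hreg : M.IsRegular)
    (g : BoundedContinuousFunction K ℝ) :
    ∃ G : BoundedContinuousFunction K ℝ, ∀ y, G y = M.markovOp g y :=
  hreg.exists_boundedContinuous_stepMean (h := fun e y => g (M.w e y))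
    (fun e => g.continuous.comp_continuousOn (hreg.continuousOn_w e))
    fun _ => ⟨‖g‖, fun _ _ => g.norm_coe_le_norm _⟩

/-- Almost surely, the empirical measures of the orbit are asymptotically invariant. -/
theorem ae_tendsto_orbitMean_markovOp_sub [MeasurableSpace E]
    [DiscreteMeasurableSpace E] (x : K) (g : BoundedContinuousFunction K ℝ) :
    ∀ᵐ σ ∂(M.pathMeasure x),
      Tendsto (M.orbitMean x (fun y => M.markovOp g y - g y) σ) atTop (𝓝 0) := by
  have hC : ∀ k, ∫ σ, g (M.w (σ k) (M.orbit x σ k)) ^ 2 ∂(M.pathMeasure x) ≤ ‖g‖ ^ 2 := by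
    intro k
    refine (integral_mono (M.integrable_comp_orbit x (k + 1) fun y => g y ^ 2)
      (integrable_const (‖g‖ ^ 2)) fun σ => ?_).trans (by simp)
    exact sq_le_sq' (neg_le_of_abs_le (g.norm_coe_le_norm _)) (g.apply_le_norm _)
  filter_upwards [M.ae_tendsto_sub_stepMean x (fun e y => g (M.w e y)) _ hC] with σ hσ
  -- The increments of `g` along the orbit telescope to a bounded quantity; subtracting the
  -- martingale differences leaves `markovOp g - g`.
  have h1 : Tendsto (fun n : ℕ => (g (M.orbit x σ n) - g (M.orbit x σ 0)) / (n : ℝ)) atTop (𝓝 0) := by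
    refine squeeze_zero_norm (fun n => ?_) (tendsto_const_div_atTop_nhds_zero_nat (2 * ‖g‖))
    rw [norm_div, Real.norm_natCast]
    gcongr
    exact g.dist_le_two_norm _ _
  have h2 := h1.sub hσ
  rw [sub_zero] at h2
  refine h2.congr fun n => ?_
  rw [orbitMean, ← sub_div, ← Finset.sum_range_sub (fun k => g (M.orbit x σ k)) n,
    ← Finset.sum_sub_distrib]
  congr 1
  refine Finset.sum_congr rfl fun k _ => ?_
  simp only [orbit, markovOp, stepMean]
  ring

variable [BorelSpace K]

/-- The distribution after one step of the system, for the initial distribution `ν`. -/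
theorem IsRegular.exists_stepDistribution (hreg : M.IsRegular) (ν : Measure K)
    [IsProbabilityMeasure ν] :
    ∃ ρ : Measure K, IsProbabilityMeasure ρ ∧
      ∀ g : BoundedContinuousFunction K ℝ, ∫ y, g y ∂ρ = ∫ y, M.markovOp g y ∂ν := by
  have hpm : ∀ e, Measurable (M.p e) := fun e =>
    (hreg.continuous_of_continuousOn (hreg.continuousOn_p e) (M.p_eq_zero e)).measurable
  set η : E → Measure K := fun e => ν.withDensity fun y => ENNReal.ofReal (M.p e y) with hη
  -- The values of `w_e` off its piece are arbitrary, so measurability is recovered from the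
  -- concentration of `η e` on that piece.
  have hηres : ∀ e, (η e).restrict (M.vertexSet (M.ini e)) = η e := by
    intro e
    rw [Measure.restrict_eq_self_of_ae_mem]
    rw [hη, ae_withDensity_iff (hpm e).ennreal_ofReal]
    refine ae_of_all _ fun y hy => ?_
    by_contra hne
    exact hy (by rw [M.p_eq_zero e y hne, ENNReal.ofReal_zero])
  have hw : ∀ e, AEMeasurable (M.w e) (η e) := fun e => hηres e ▸
    (hreg.continuousOn_w e).aemeasurable (M.measurableSet_vertexSet _)
  have hη1 : ∑ e, η e Set.univ = 1 := by
    simp only [hη, withDensity_apply _ MeasurableSet.univ, Measure.restrict_univ]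
    rw [← lintegral_finsetSum _ fun e _ => (hpm e).ennreal_ofReal]
    simp only [← ENNReal.ofReal_sum_of_nonneg fun e _ => M.p_nonneg e _, M.sum_p]
    simp
  have hηfin : ∀ e, IsFiniteMeasure (η e) := fun e => ⟨by
    refine lt_of_le_of_lt ?_ ENNReal.one_lt_top
    rw [← hη1]
    exact Finset.single_le_sum (f := fun e => η e Set.univ) (fun _ _ => zero_le)
      (Finset.mem_univ e)⟩
  refine ⟨∑ e, (η e).map (M.w e), ⟨?_⟩, fun g => ?_⟩
  · rw [Measure.coe_finsetSum, Finset.sum_apply, ← hη1]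
    exact Finset.sum_congr rfl fun e _ => by
      rw [Measure.map_apply_of_aemeasurable (hw e) MeasurableSet.univ, Set.preimage_univ]
  · rw [integral_finsetSum_measure fun e _ => g.integrable _]
    have hterm : ∀ e, ∫ y, g y ∂((η e).map (M.w e)) = ∫ y, M.p e y * g (M.w e y) ∂ν := by
      intro e
      rw [integral_map (hw e) g.continuous.measurable.aestronglyMeasurable, hη,
        integral_withDensity_eq_integral_toReal_smul (hpm e).ennreal_ofReal
          (ae_of_all _ fun _ => ENNReal.ofReal_lt_top)]
      simp [ENNReal.toReal_ofReal (M.p_nonneg e _)]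
    simp only [hterm, markovOp]
    rw [integral_finsetSum]
    intro e _
    have hcont : Continuous fun y => M.p e y * g (M.w e y) :=
      hreg.continuous_of_continuousOn ((hreg.continuousOn_p e).mul
        (g.continuous.comp_continuousOn (hreg.continuousOn_w e))) fun y hy => by
          rw [M.p_eq_zero e y hy, zero_mul]
    refine Integrable.of_bound hcont.measurable.aestronglyMeasurable ‖g‖ (ae_of_all _ fun y => ?_)
    have hp1 : M.p e y ≤ 1 := by
      rw [← M.sum_p y]
      exact Finset.single_le_sum (fun e _ => M.p_nonneg e y) (Finset.mem_univ e)
    rw [norm_mul, Real.norm_of_nonneg (M.p_nonneg e y)]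
    exact (mul_le_of_le_one_left (norm_nonneg _) hp1).trans (g.norm_coe_le_norm _)

/-- Invariance can be tested on countably many functions. -/
theorem IsRegular.exists_countable_isInvariant [TopologicalSpace.SeparableSpace K]
    (hreg : M.IsRegular) :
    ∃ g : ℕ → BoundedContinuousFunction K ℝ, ∀ ν : Measure K, IsProbabilityMeasure ν →
      (∀ n, ∫ y, M.markovOp (g n) y ∂ν = ∫ y, g n y ∂ν) → M.IsInvariant ν := by
  obtain ⟨g, hg⟩ := exists_countable_determining (K := K)
  refine ⟨g, fun ν hν h G => ?_⟩
  obtain ⟨ρ, hρ, hρν⟩ := hreg.exists_stepDistribution ν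
  rw [← hρν, hg ρ ν fun n => (hρν (g n)).trans (h n)]

variable [CompleteSpace K] [TopologicalSpace.SeparableSpace K] [MeasurableSpace E]
  [DiscreteMeasurableSpace E]

theorem ae_isTightMeasureSet_empiricalMeasure (hcontr : M.IsContractive) (x : K) :
    ∀ᵐ σ ∂(M.pathMeasure x),
      IsTightMeasureSet (Set.range (empiricalMeasure (M.orbit x σ))) := by
  filter_upwards [ae_exists_finite_orbitMean_sqrt_infDist_le hcontr x] with σ hσ
  have : Nonempty K := ⟨x⟩
  refine isTightMeasureSet_range_of_infDist fun ε hε => ?_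
  -- Markov's inequality at level `√ε` turns a mean of at most `√ε * ε` into mass at most `ε`.
  obtain ⟨A, hAf, hAn, hA⟩ := hσ (√ε * ε) (by positivity)
  refine ⟨A, hAf, hAn, ?_⟩
  filter_upwards [(tendsto_add_atTop_nat 1).eventually hA] with n hn
  have h1 := mul_meas_ge_le_integral_of_nonneg
    (μ := empiricalMeasure (M.orbit x σ) n) (f := fun y => √(Metric.infDist y A))
    (ae_of_all _ fun y => Real.sqrt_nonneg _) (integrable_empiricalMeasure _ _ _) (√ε)
  rw [integral_empiricalMeasure] at h1
  have h2 := le_of_mul_le_mul_left (h1.trans hn) (Real.sqrt_pos.2 hε)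
  have h3 : {y | ε ≤ Metric.infDist y A} = {y | √ε ≤ √(Metric.infDist y A)} := by
    ext y
    exact (Real.sqrt_le_sqrt_iff Metric.infDist_nonneg).symm
  rw [h3, ← ofReal_measureReal]
  exact ENNReal.ofReal_le_ofReal h2

/-- If the invariant probability measure `μ` is unique, then almost surely the empirical measures
of the orbit converge weakly to `μ`. -/
theorem ae_tendsto_orbitMean (hreg : M.IsRegular) (hcontr : M.IsContractive) {μ : Measure K}
    [IsProbabilityMeasure μ]
    (huniq : ∀ ν : Measure K, IsProbabilityMeasure ν → M.IsInvariant ν → ν = μ) (x : K) :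
    ∀ᵐ σ ∂(M.pathMeasure x), ∀ g : BoundedContinuousFunction K ℝ,
      Tendsto (M.orbitMean x g σ) atTop (𝓝 (∫ y, g y ∂μ)) := by
  -- Countably many test functions allow one null set to be fixed before any cluster point is
  -- considered.
  obtain ⟨g, hg⟩ := hreg.exists_countable_isInvariant
  filter_upwards [ae_isTightMeasureSet_empiricalMeasure hcontr x,
    ae_all_iff.2 fun i => ae_tendsto_orbitMean_markovOp_sub (M := M) x (g i)] with σ htight hinv
  set ν : ℕ → ProbabilityMeasure K := fun n => ⟨empiricalMeasure (M.orbit x σ) n, inferInstance⟩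
    with hν
  have hint : ∀ n (G : BoundedContinuousFunction K ℝ),
      ∫ y, G y ∂(ν n : Measure K) = M.orbitMean x G σ (n + 1) :=
    fun n G => integral_empiricalMeasure _ _ _
  have hcomp : IsCompact (closure (Set.range ν)) := by
    refine isCompact_closure_of_isTightMeasureSet (htight.subset ?_)
    rintro _ ⟨_, ⟨n, rfl⟩, rfl⟩
    exact ⟨n, rfl⟩
  have hcont : ∀ G : BoundedContinuousFunction K ℝ,
      Continuous fun ρ : ProbabilityMeasure K => ∫ y, G y ∂(ρ : Measure K) := fun G =>
    continuous_iff_continuousAt.2 fun ρ =>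
      ProbabilityMeasure.tendsto_iff_forall_integral_tendsto.1 tendsto_id G
  have hlim : Tendsto ν atTop (𝓝 ⟨μ, inferInstance⟩) := by
    -- In a compact set, a sequence with a single possible cluster point converges to it.
    refine hcomp.tendsto_nhds_of_unique_mapClusterPt
      (Eventually.of_forall fun n => subset_closure ⟨n, rfl⟩) fun ρ _ hρ => ?_
    refine Subtype.ext (huniq ρ inferInstance (hg ρ inferInstance fun i => ?_))
    obtain ⟨G, hG⟩ := hreg.exists_boundedContinuous_markovOp (g i)
    have h1 : Tendsto (fun n => ∫ y, (G - g i) y ∂(ν n : Measure K)) atTop (𝓝 0) := by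
      refine ((hinv i).comp (tendsto_add_atTop_nat 1)).congr fun n => ?_
      rw [hint]
      simp [orbitMean, hG]
    have h2 : MapClusterPt (∫ y, (G - g i) y ∂(ρ : Measure K)) atTop
        (fun n => ∫ y, (G - g i) y ∂(ν n : Measure K)) :=
      hρ.continuousAt_comp (hcont (G - g i)).continuousAt
    have h3 : ∫ y, (G - g i) y ∂(ρ : Measure K) = 0 := by
      have := h2.neBot.mono (inf_le_inf_left _ h1)
      exact eq_of_nhds_neBot this
    simp only [BoundedContinuousFunction.coe_sub, Pi.sub_apply] at h3
    rw [integral_sub (G.integrable _) ((g i).integrable _), sub_eq_zero] at h3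
    rw [← h3]
    simp only [hG]
  intro G
  -- The empirical measure with index `n` averages `n + 1` points.
  rw [← tendsto_add_atTop_iff_nat 1]
  exact (ProbabilityMeasure.tendsto_iff_forall_integral_tendsto.1 hlim G).congr fun n => hint n G

end Feller

end MarkovSystem

/-! ### The ergodic theorem for edge-dependent functions -/

theorem EReal.coe_sum {ι : Type*} (s : Finset ι) (u : ι → ℝ) :
    ((∑ i ∈ s, u i : ℝ) : EReal) = ∑ i ∈ s, (u i : EReal) :=
  map_sum (⟨⟨Real.toEReal, EReal.coe_zero⟩, EReal.coe_add⟩ : ℝ →+ EReal) u s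

theorem corollary2 {K V E : Type*} [MetricSpace K] [CompleteSpace K]
    [TopologicalSpace.SeparableSpace K] [MeasurableSpace K] [BorelSpace K]
    [Fintype E] [MeasurableSpace E] [DiscreteMeasurableSpace E]
    (M : MarkovSystem K V E) (hreg : M.IsRegular) (hcontr : M.IsContractive)
    (μ : Measure K) [IsProbabilityMeasure μ] (hμ : M.IsInvariant μ)
    (huniq : ∀ ν : Measure K, IsProbabilityMeasure ν → M.IsInvariant ν → ν = μ)
    (f : E → K → EReal) (hf_meas : ∀ e, Measurable (f e))
    (hf_cont : ∀ e, ContinuousOn (f e) (M.vertexSet (M.ini e)))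
    (hf_bdd : ∀ e, ∃ C : ℝ, ∀ x ∈ M.vertexSet (M.ini e),
      ((-C : ℝ) : EReal) ≤ f e x ∧ f e x ≤ ((C : ℝ) : EReal))
    (x : K) :
    ∀ᵐ σ ∂(M.pathMeasure x),
      Tendsto
        (fun n : ℕ => ((1 / (n : ℝ) : ℝ) : EReal) *
          ∑ k ∈ Finset.range n, f (σ k) (M.orbit x σ k))
        atTop
        (𝓝 ((∑ e, ∫ y in M.vertexSet (M.ini e), M.p e y * (f e y).toReal ∂μ : ℝ) : EReal)) := by
  classical
  have hfin : ∀ e, ∀ y ∈ M.vertexSet (M.ini e), f e y ≠ ⊤ ∧ f e y ≠ ⊥ := by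
    intro e y hy
    obtain ⟨C, hC⟩ := hf_bdd e
    exact ⟨((hC y hy).2.trans_lt (EReal.coe_lt_top C)).ne,
      ((EReal.bot_lt_coe (-C)).trans_le (hC y hy).1).ne'⟩
  -- Off its piece `f e` may be infinite or discontinuous. The real truncation `h e` agrees with it
  -- along almost every orbit, which never takes an edge outside its domain.
  set h : E → K → ℝ := fun e => (M.vertexSet (M.ini e)).indicator fun y => (f e y).toReal with hh
  have hh_eq : ∀ e, ∀ y ∈ M.vertexSet (M.ini e), h e y = (f e y).toReal :=
    fun e y hy => Set.indicator_of_mem hy _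
  have hhc : ∀ e, ContinuousOn (h e) (M.vertexSet (M.ini e)) := by
    intro e
    refine ContinuousOn.congr ?_ (hh_eq e)
    exact EReal.continuousOn_toReal.comp (hf_cont e) fun y hy => by
      simpa [and_comm] using hfin e y hy
  have hhb : ∀ e, ∃ C, 0 ≤ C ∧ ∀ y, |h e y| ≤ C := by
    intro e
    obtain ⟨C, hC⟩ := hf_bdd e
    refine ⟨|C|, abs_nonneg C, fun y => ?_⟩
    by_cases hy : y ∈ M.vertexSet (M.ini e)
    · rw [hh_eq e y hy]
      obtain ⟨h1, h2⟩ := hC y hy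
      rw [← EReal.coe_toReal (hfin e y hy).1 (hfin e y hy).2] at h1 h2
      exact (abs_le.2 ⟨EReal.coe_le_coe_iff.1 h1, EReal.coe_le_coe_iff.1 h2⟩).trans
        (le_abs_self C)
    · simp [hh, hy]
  obtain ⟨G, hG⟩ := hreg.exists_boundedContinuous_stepMean hhc fun e =>
    let ⟨C, _, hC⟩ := hhb e; ⟨C, fun y _ => hC y⟩
  have hGμ : ∫ y, G y ∂μ = ∑ e, ∫ y in M.vertexSet (M.ini e), M.p e y * (f e y).toReal ∂μ := by
    simp only [hG, MarkovSystem.stepMean]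
    rw [integral_finsetSum]
    · refine Finset.sum_congr rfl fun e _ => ?_
      rw [← integral_indicator (M.measurableSet_vertexSet _)]
      refine integral_congr_ae (ae_of_all _ fun y => ?_)
      by_cases hy : y ∈ M.vertexSet (M.ini e)
      · simp [hy, hh]
      · simp [hy, hh]
    · intro e _
      obtain ⟨C, -, hC⟩ := hhb e
      have hcont : Continuous fun y => M.p e y * h e y :=
        hreg.continuous_of_continuousOn ((hreg.continuousOn_p e).mul (hhc e)) fun y hy => by
          rw [M.p_eq_zero e y hy, zero_mul]
      refine Integrable.of_bound hcont.measurable.aestronglyMeasurable C (ae_of_all _ fun y => ?_)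
      have hp1 : M.p e y ≤ 1 := by
        rw [← M.sum_p y]
        exact Finset.single_le_sum (fun e _ => M.p_nonneg e y) (Finset.mem_univ e)
      rw [norm_mul, Real.norm_of_nonneg (M.p_nonneg e y)]
      exact (mul_le_of_le_one_left (norm_nonneg _) hp1).trans (hC y)
  choose C hC0 hC using hhb
  have hL2 : ∀ k, ∫ σ, h (σ k) (M.orbit x σ k) ^ 2 ∂(M.pathMeasure x) ≤ (∑ e, C e) ^ 2 := by
    intro k
    refine (integral_mono ((M.dependsOn_edge_orbit x k fun e y => h e y ^ 2).integrable_of_Iio _)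
      (integrable_const ((∑ e, C e) ^ 2)) fun σ => ?_).trans (by simp)
    have : |h (σ k) (M.orbit x σ k)| ≤ ∑ e, C e := (hC _ _).trans
      (Finset.single_le_sum (fun e _ => hC0 e) (Finset.mem_univ (σ k)))
    exact sq_le_sq' (neg_le_of_abs_le this) (le_of_abs_le this)
  filter_upwards [M.ae_orbit_mem_vertexSet x, M.ae_tendsto_sub_stepMean x h _ hL2,
    MarkovSystem.ae_tendsto_orbitMean hreg hcontr huniq x] with σ hmem hdev hmean
  have hreal := hdev.add (hmean G)
  rw [zero_add, hGμ] at hreal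
  refine ((continuous_coe_real_ereal.tendsto _).comp hreal).congr fun n => ?_
  have hsum : ∑ k ∈ Finset.range n, f (σ k) (M.orbit x σ k) =
      ((∑ k ∈ Finset.range n, h (σ k) (M.orbit x σ k) : ℝ) : EReal) := by
    rw [EReal.coe_sum]
    refine Finset.sum_congr rfl fun k _ => ?_
    rw [hh_eq _ _ (hmem k), EReal.coe_toReal (hfin _ _ (hmem k)).1 (hfin _ _ (hmem k)).2]
  rw [hsum, ← EReal.coe_mul, Function.comp_apply]
  congr 1
  simp only [MarkovSystem.orbitMean, hG, Finset.sum_sub_distrib]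
  ring
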